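/- Let $X$ be a topological group and let $X_0\subseteq X_1\subseteq X_2\subseteq\cdots$ be subgroups of $X$ with union $X$, each metrizable in the subspace topology, such that $X_n$ is closed in $X_{n+1}$ for every $n$. Suppose that $X$ is the inductive limit of the $X_n$, that is, a set $U\subseteq X$ is open if and only if $U\cap X_n$ is open in $X_n$ for every $n$. A Tychonoff space $Z$ is called Ascoli if every compact subset of the space $C(Z)$ of continuous real-valued functions on $Z$, with the compact-open topology, is equicontinuous. A space is called an $\mathcal{MK}_\omega$-space if it is the union of an increasing sequence $(C_n)$ of metrizable compact subsets such that a set $U$ is open if and only if $U\cap C_n$ is open in $C_n$ for every $n$. Then $X$ is Ascoli if and only if at least one of the following holds: (1) there is $m$ such that $X_n$ is open in $X_{n+1}$ for every $n\ge m$; (2) every $X_n$ is locally compact. If (1) holds, then $X$ is metrizable. If (2) holds, then $X$ has an open subgroup which is an $\mathcal{MK}_\omega$-space, and $X$ is sequential; if (2) holds and (1) fails, then $X$ is not Fréchet–Urysohn. -/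

import Mathlib

open Topology

/-- The topological space `X` is the inductive limit of the increasing sequence `C 0 ⊆ C 1 ⊆ ...` of
its subspaces: `X` is the union of the `C n`, and a set `U` is open in `X` if and only if `U ∩ C n`
is open in `C n` for every `n`. -/
structure IsInductiveLimit {X : Type*} [TopologicalSpace X] (C : ℕ → Set X) : Prop where
  mono : ∀ n, C n ⊆ C (n + 1)
  iUnion_eq : ⋃ n, C n = Set.univ
  isOpen_iff : ∀ U : Set X, IsOpen U ↔ ∀ n, IsOpen ((fun x : C n => (x : X)) ⁻¹' U)

/-- An `MK_ω`-space: the inductive limit of an increasing sequence of metrizable compact subsets. -/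
def IsMKOmegaSpace (X : Type*) [TopologicalSpace X] : Prop :=
  ∃ C : ℕ → Set X, (∀ n, IsCompact (C n)) ∧ (∀ n, TopologicalSpace.MetrizableSpace (C n)) ∧ IsInductiveLimit C

/-- An Ascoli space: a Tychonoff space `X` such that every compact subset of `C(X, ℝ)`, endowed with
the compact-open topology, is equicontinuous. -/
structure IsAscoliSpace (X : Type*) [TopologicalSpace X] : Prop where
  tychonoff : T35Space X
  equicontinuous : ∀ K : Set C(X, ℝ), IsCompact K → Equicontinuous (fun f : K => (f.1 : X → ℝ))

/-- From some index on, each `H n` is open in `H (n + 1)`. -/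
def EventuallyOpenInNext {X : Type*} [Group X] [TopologicalSpace X] (H : ℕ → Subgroup X) : Prop :=
  ∃ m, ∀ n, m ≤ n → IsOpen ((H n).subgroupOf (H (n + 1)) : Set (H (n + 1)))

/-!
A set is closed in `X` exactly when its trace on each `H n` is closed, so `X` inherits the property
of being sequential from the metrizable groups `H n`; it is also `T1`, hence Tychonoff as a
topological group. Every sequential Tychonoff space is Ascoli (`isAscoliSpace_of_sequentialSpace`).
Thus the Ascoli property holds automatically, and the content of the equivalence is that one of the
two alternatives always holds (`locallyCompactSpace_of_not_eventuallyOpenInNext`). The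
assumption that enters there is that the inductive limit topology is a group topology: if both
alternatives failed, products of sequences without convergent subsequences with null sequences that
lie in later and later stages would yield a closed set avoiding `1` but meeting `V * V` for every
neighbourhood `V` of `1`.

If the tower is eventually open, then some `H m` is an open subgroup of `X`, so `X` is
first countable, hence metrizable. If it is not, then `X` contains double sequences
`z i * y i k` with `y i k` tending to `1` for fixed `i` and `z i` tending to `1`, arranged so that no
sequence of such products converges to `1`; so `X` is not Fréchet-Urysohn
(`not_frechetUrysohnSpace_of_not_eventuallyOpenInNext`). If all `H n` are locally compact, powers of
growing compact neighbourhoods of the identity exhaust an open subgroup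
(`exists_isOpen_subgroup_isMKOmegaSpace`).

Closedness in `X` is mostly verified by
`IsInductiveLimit.isClosed_iUnion_of_disjoint`: a union of closed sets `A i` with `A i` disjoint from
the `i`-th stage is closed.
-/

open Filter Set TopologicalSpace
open scoped Pointwise

/-! ### Inductive limits of increasing sequences of subspaces -/

namespace IsInductiveLimit

variable {X : Type*} [TopologicalSpace X] {C : ℕ → Set X}

theorem monotone (hC : IsInductiveLimit C) : Monotone C :=
  monotone_nat_of_le_succ hC.mono

theorem exists_mem (hC : IsInductiveLimit C) (x : X) : ∃ n, x ∈ C n :=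
  mem_iUnion.1 (hC.iUnion_eq ▸ mem_univ x)

theorem isClosed_iff (hC : IsInductiveLimit C) {A : Set X} :
    IsClosed A ↔ ∀ n, IsClosed ((fun x : C n => (x : X)) ⁻¹' A) := by
  simp only [← isOpen_compl_iff, hC.isOpen_iff, preimage_compl]

theorem sequentialSpace (hC : IsInductiveLimit C) (h : ∀ n, SequentialSpace (C n)) :
    SequentialSpace X where
  isClosed_of_seq A hA := by
    refine hC.isClosed_iff.2 fun n => ?_
    have := h n
    exact (hA.preimage continuous_subtype_val.seqContinuous).isClosed

theorem t1Space (hC : IsInductiveLimit C) (h : ∀ n, T1Space (C n)) : T1Space X where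
  t1 x := by
    refine hC.isClosed_iff.2 fun n => ?_
    have := h n
    exact (subsingleton_singleton.preimage Subtype.val_injective).isClosed

theorem isClosed_of_isClosed_succ (hC : IsInductiveLimit C)
    (h : ∀ n, IsClosed ((fun x : C (n + 1) => (x : X)) ⁻¹' C n)) (n : ℕ) : IsClosed (C n) := by
  have key : ∀ k (hk : n ≤ k), IsClosedEmbedding (inclusion (hC.monotone hk)) := by
    refine Nat.le_induction IsClosedEmbedding.id fun k hk ih => ?_
    have : IsClosedEmbedding (inclusion (hC.mono k)) :=
      ⟨.inclusion _, by rw [range_inclusion]; exact h k⟩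
    exact this.comp ih
  refine hC.isClosed_iff.2 fun k => ?_
  rcases le_total n k with hk | hk
  · have := (key k hk).isClosed_range
    rwa [range_inclusion] at this
  · rw [preimage_eq_univ_iff.2 (by simpa using hC.monotone hk)]
    exact isClosed_univ

theorem isOpen_of_isOpen_succ (hC : IsInductiveLimit C) {m : ℕ}
    (h : ∀ n, m ≤ n → IsOpen ((fun x : C (n + 1) => (x : X)) ⁻¹' C n)) : IsOpen (C m) := by
  have key : ∀ k (hk : m ≤ k), IsOpenEmbedding (inclusion (hC.monotone hk)) := by
    refine Nat.le_induction IsOpenEmbedding.id fun k hk ih => ?_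
    have : IsOpenEmbedding (inclusion (hC.mono k)) :=
      ⟨.inclusion _, by rw [range_inclusion]; exact h k hk⟩
    exact this.comp ih
  refine (hC.isOpen_iff _).2 fun k => ?_
  rcases le_total m k with hk | hk
  · have := (key k hk).isOpen_range
    rwa [range_inclusion] at this
  · rw [preimage_eq_univ_iff.2 (by simpa using hC.monotone hk)]
    exact isOpen_univ

/-- Closed sets that escape to infinity along the tower have a closed union, because each stage
meets only finitely many of them. -/
theorem isClosed_iUnion_of_disjoint (hC : IsInductiveLimit C) {A : ℕ → Set X}
    (hA : ∀ i, IsClosed (A i)) (hd : ∀ i, Disjoint (A i) (C i)) : IsClosed (⋃ i, A i) := by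
  refine hC.isClosed_iff.2 fun n => ?_
  have : (fun x : C n => (x : X)) ⁻¹' (⋃ i, A i) =
      (fun x : C n => (x : X)) ⁻¹' (⋃ i ∈ Finset.range n, A i) := by
    ext ⟨x, hx⟩
    simp only [mem_preimage, mem_iUnion, Finset.mem_range, exists_prop]
    refine ⟨fun ⟨i, hi⟩ => ⟨i, ?_, hi⟩, fun ⟨i, _, hi⟩ => ⟨i, hi⟩⟩
    by_contra hni
    exact disjoint_left.1 (hd i) hi (hC.monotone (not_lt.1 hni) hx)
  rw [this]
  exact ((Finset.range n).finite_toSet.isClosed_biUnion fun i _ => hA i).preimage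
    continuous_subtype_val

end IsInductiveLimit

/-! ### Sequential spaces -/

/-- A Tychonoff sequential space is Ascoli: for compact `K` in `C(X, ℝ)`, the map from `X` to the
functions on `K` that sends a point to evaluation there is continuous along every convergent
sequence, since such a sequence together with its limit is an image of the compact space
`OnePoint ℕ`. -/
theorem isAscoliSpace_of_sequentialSpace {X : Type*} [TopologicalSpace X] [T35Space X]
    [SequentialSpace X] : IsAscoliSpace X where
  tychonoff := inferInstance
  equicontinuous K hK := by
    have : CompactSpace K := isCompact_iff_compactSpace.1 hK
    rw [equicontinuous_iff_continuous]
    refine SeqContinuous.continuous fun u a hu => ?_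
    let s : C(OnePoint ℕ, X) := OnePoint.continuousMapMkNat u a hu
    let e : C(K, C(OnePoint ℕ, ℝ)) :=
      ⟨fun f => f.1.comp s, (ContinuousMap.continuous_precomp s).comp continuous_subtype_val⟩
    let g : C(OnePoint ℕ, C(K, ℝ)) := (e.uncurry.comp ContinuousMap.prodSwap).curry
    have hg := (OnePoint.continuous_iff_from_nat g).1 g.continuous
    rw [ContinuousMap.tendsto_iff_tendstoUniformly] at hg
    rw [UniformFun.tendsto_iff_tendstoUniformly]
    exact hg

theorem isClosed_range_of_forall_not_tendsto {X : Type*} [TopologicalSpace X] [T1Space X]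
    [SequentialSpace X] {u : ℕ → X}
    (hu : ∀ (φ : ℕ → ℕ) (a : X), Tendsto φ atTop atTop → ¬ Tendsto (u ∘ φ) atTop (𝓝 a)) :
    IsClosed (range u) := by
  refine IsSeqClosed.isClosed fun v a hv hva => ?_
  choose φ hφ using hv
  obtain rfl : u ∘ φ = v := funext hφ
  have hnot : ¬ Tendsto φ atTop atTop := fun h => hu φ a h hva
  simp only [tendsto_atTop, not_forall, not_eventually, not_le] at hnot
  obtain ⟨N, hN⟩ := hnot
  have hcl : IsClosed (u '' Iio N) := ((finite_Iio N).image u).isClosed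
  exact image_subset_range _ _
    (hcl.mem_of_frequently_of_tendsto (hN.mono fun j hj => mem_image_of_mem u hj) hva)

/-! ### Sequences in topological groups -/

section Group

variable {X : Type*} [Group X] [TopologicalSpace X] [IsTopologicalGroup X]

theorem metrizableSpace_of_isOpen_subgroup [T1Space X] {G : Subgroup X} (hG : IsOpen (G : Set X))
    [MetrizableSpace G] : MetrizableSpace X := by
  have h1 : (𝓝 (1 : X)).IsCountablyGenerated := by
    have := hG.isOpenEmbedding_subtypeVal.map_nhds_eq (1 : G)
    rw [← show ((1 : G) : X) = 1 from rfl]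
    exact this ▸ inferInstance
  let _ : UniformSpace X := IsTopologicalGroup.rightUniformSpace X
  have : (uniformity X).IsCountablyGenerated := by
    rw [uniformity_eq_comap_nhds_one']
    infer_instance
  exact UniformSpace.metrizableSpace

theorem exists_seq_tendsto_one_of_not_isOpen_subgroupOf {G K : Subgroup X}
    [FrechetUrysohnSpace K] (h : ¬ IsOpen (G.subgroupOf K : Set K)) :
    ∃ y : ℕ → X, (∀ k, y k ∈ K) ∧ (∀ k, y k ∉ G) ∧ Tendsto y atTop (𝓝 1) := by
  have h1 : (1 : K) ∈ closure ((G.subgroupOf K : Set K)ᶜ) := by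
    rw [closure_compl]
    exact fun h1 => h (Subgroup.isOpen_of_mem_nhds _ (mem_interior_iff_mem_nhds.1 h1))
  obtain ⟨y, hy, hlim⟩ := mem_closure_iff_seq_limit.1 h1
  exact ⟨fun k => y k, fun k => (y k).2, fun k => hy k,
    (continuous_subtype_val.tendsto (1 : K)).comp hlim⟩

/-- Every neighbourhood of the identity of a closed metrizable subgroup that is not locally compact
contains a sequence without convergent subsequences. -/
theorem exists_seq_forall_not_tendsto {G : Subgroup X} (hcl : IsClosed (G : Set X))
    [MetrizableSpace G] (hG : ¬ LocallyCompactSpace G) {s : Set G} (hs : s ∈ 𝓝 1) :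
    ∃ x : ℕ → X, (∀ k, x k ∈ Subtype.val '' s) ∧
      ∀ (φ : ℕ → ℕ) (a : X), Tendsto φ atTop atTop → ¬ Tendsto (x ∘ φ) atTop (𝓝 a) := by
  let _ : MetricSpace G := metrizableSpaceMetric G
  obtain ⟨t, ht, htcl, hts⟩ := exists_mem_nhds_isClosed_subset hs
  have hnc : ¬ IsSeqCompact t := fun h =>
    hG ((isCompact_iff_isSeqCompact.2 h).locallyCompactSpace_of_mem_nhds_of_group ht)
  simp only [IsSeqCompact, not_forall, not_exists, not_and] at hnc
  obtain ⟨x, hxt, hx⟩ := hnc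
  refine ⟨fun k => x k, fun k => ⟨x k, hts (hxt k), rfl⟩, fun φ a hφ hlim => ?_⟩
  lift a to G using hcl.mem_of_tendsto hlim (Eventually.of_forall fun k => (x (φ k)).2)
  have hlim' : Tendsto (x ∘ φ) atTop (𝓝 a) := tendsto_subtype_rng.2 hlim
  obtain ⟨ψ, hψ, hφψ⟩ := strictMono_subseq_of_tendsto_atTop hφ
  exact hx a (htcl.mem_of_tendsto hlim' (Eventually.of_forall fun k => hxt (φ k))) (φ ∘ ψ) hφψ
    (hlim'.comp hψ.tendsto_atTop)

/-- If `x` has no convergent subsequence and `y` tends to the identity, then neither has `x * y` a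
convergent subsequence, so its range is closed. -/
theorem isClosed_range_mul_of_forall_not_tendsto [T1Space X] [SequentialSpace X] {x y : ℕ → X}
    (hx : ∀ (φ : ℕ → ℕ) (a : X), Tendsto φ atTop atTop → ¬ Tendsto (x ∘ φ) atTop (𝓝 a))
    (hy : Tendsto y atTop (𝓝 1)) : IsClosed (range fun k => x k * y k) := by
  refine isClosed_range_of_forall_not_tendsto fun φ a hφ hlim => hx φ a hφ ?_
  have := hlim.mul (hy.comp hφ).inv
  simpa [Function.comp_def] using this

end Group

/-! ### Towers of metrizable groups -/

section Tower

variable {X : Type*} [Group X] [TopologicalSpace X] [IsTopologicalGroup X] {H : ℕ → Subgroup X}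

/-- If infinitely many `H n` are not open in the next one, then continuity of the multiplication
forces every `H n` to be locally compact. Otherwise a non-locally compact `H n` contains, inside
the `i`-th member of a countable neighbourhood base of its identity, a sequence `x i` without convergent subsequences, and
there are sequences `y i` tending to `1` outside `H i`. The products `x i k * y i k` form a closed
set that avoids `1`, but they enter `V * V` for each neighbourhood `V` of `1`. -/
theorem locallyCompactSpace_of_not_eventuallyOpenInNext
    (hlim : IsInductiveLimit (fun n => (H n : Set X)))
    (hmetr : ∀ n, MetrizableSpace (H n)) (hcl : ∀ n, IsClosed (H n : Set X))
    (hopen : ¬ EventuallyOpenInNext H) (n : ℕ) : LocallyCompactSpace (H n) := by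
  by_contra hn
  have : T1Space X := hlim.t1Space fun n => have := hmetr n; inferInstanceAs (T1Space (H n))
  have : SequentialSpace X :=
    hlim.sequentialSpace fun n => have := hmetr n; inferInstanceAs (SequentialSpace (H n))
  have := hmetr n
  obtain ⟨B, hB⟩ := (𝓝 (1 : H n)).exists_antitone_basis
  choose x hxB hx using fun i => exists_seq_forall_not_tendsto (hcl n) hn (hB.mem i)
  simp only [EventuallyOpenInNext, not_exists, not_forall] at hopen
  choose m hm hmo using fun i => hopen (max n i)
  choose y _ hyH hy using fun i =>
    have := hmetr (m i + 1)
    exists_seq_tendsto_one_of_not_isOpen_subgroupOf (hmo i)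
  have hxH : ∀ i k, x i k ∈ H (m i) := fun i k => by
    obtain ⟨z, -, hz⟩ := hxB i k
    exact hz ▸ hlim.monotone ((le_max_left n i).trans (hm i)) z.2
  have hxy : ∀ i k, x i k * y i k ∉ H (m i) := fun i k h =>
    hyH i k (((H (m i)).mul_mem_cancel_left (hxH i k)).1 h)
  have hA : IsClosed (⋃ i, range fun k => x i k * y i k) := by
    refine hlim.isClosed_iUnion_of_disjoint
      (fun i => isClosed_range_mul_of_forall_not_tendsto (hx i) (hy i)) fun i => ?_
    rw [disjoint_left]
    rintro _ ⟨k, rfl⟩ h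
    exact hxy i k (hlim.monotone ((le_max_right n i).trans (hm i)) h)
  have h1 : (⋃ i, range fun k => x i k * y i k)ᶜ ∈ 𝓝 (1 : X) := by
    refine hA.isOpen_compl.mem_nhds ?_
    simp only [mem_compl_iff, mem_iUnion, mem_range, not_exists]
    exact fun i k h => hxy i k (h ▸ one_mem _)
  obtain ⟨V, hVo, hV1, hV⟩ := exists_open_nhds_one_mul_subset h1
  have hVn : Subtype.val ⁻¹' V ∈ 𝓝 (1 : H n) :=
    continuous_subtype_val.continuousAt.preimage_mem_nhds (hVo.mem_nhds hV1)
  obtain ⟨i, -, hi⟩ := hB.1.mem_iff.1 hVn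
  obtain ⟨k, hk⟩ := ((hy i).eventually (hVo.mem_nhds hV1)).exists
  obtain ⟨z, hz, hzx⟩ := hxB i k
  exact hV (mul_mem_mul (hzx ▸ hi hz : x i k ∈ V) hk) (mem_iUnion.2 ⟨i, k, rfl⟩)

/-- If infinitely many `H n` are not open in the next one, there is a sequence `z` of nontrivial
elements of one `H m` tending to `1`, and sequences `y i` tending to `1` outside `H i`. The
identity is in the closure of the set of all products `z i * y i k`, but no sequence of such products
converges to it. -/
theorem not_frechetUrysohnSpace_of_not_eventuallyOpenInNext
    (hlim : IsInductiveLimit (fun n => (H n : Set X)))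
    (hmetr : ∀ n, MetrizableSpace (H n))
    (hopen : ¬ EventuallyOpenInNext H) : ¬ FrechetUrysohnSpace X := by
  intro hFU
  have : T1Space X := hlim.t1Space fun n => have := hmetr n; inferInstanceAs (T1Space (H n))
  simp only [EventuallyOpenInNext, not_exists, not_forall] at hopen
  obtain ⟨p, -, hp⟩ := hopen 0
  have := hmetr (p + 1)
  obtain ⟨z, hzp, hzp', hz⟩ := exists_seq_tendsto_one_of_not_isOpen_subgroupOf hp
  choose m hm hmo using fun i => hopen (max (p + 1) i)
  choose y _ hyH hy using fun i =>
    have := hmetr (m i + 1)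
    exists_seq_tendsto_one_of_not_isOpen_subgroupOf (hmo i)
  have hzH : ∀ i, z i ∈ H (m i) := fun i =>
    hlim.monotone ((le_max_left (p + 1) i).trans (hm i)) (hzp i)
  have hzy : ∀ i k, z i * y i k ∉ H (m i) := fun i k h =>
    hyH i k (((H (m i)).mul_mem_cancel_left (hzH i)).1 h)
  have hzlim : ∀ i, Tendsto (fun k => z i * y i k) atTop (𝓝 (z i)) := fun i => by
    simpa using (hy i).const_mul (z i)
  have h1 : (1 : X) ∈ closure (⋃ i, range fun k => z i * y i k) := by
    rw [← closure_closure]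
    exact mem_closure_of_tendsto hz (Eventually.of_forall fun i =>
      mem_closure_of_tendsto (hzlim i) (Eventually.of_forall fun k => mem_iUnion.2 ⟨i, k, rfl⟩))
  obtain ⟨a, ha, halim⟩ := mem_closure_iff_seq_limit.1 h1
  simp only [mem_iUnion, mem_range] at ha
  choose i k hik using ha
  by_cases hi : Tendsto i atTop atTop
  · -- The terms of the sequence escape to infinity along the tower, so they form a closed set.
    have hcl : IsClosed (⋃ l, a '' {j | i j = l}) := by
      refine hlim.isClosed_iUnion_of_disjoint (fun l => (Finite.image a ?_).isClosed) fun l => ?_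
      · have := (hi.eventually_gt_atTop l)
        rw [← Nat.cofinite_eq_atTop] at this
        exact this.subset fun j (hj : i j = l) => by simp [hj]
      · rw [disjoint_left]
        rintro _ ⟨j, rfl, rfl⟩ h
        rw [← hik j] at h
        exact hzy _ _ (hlim.monotone ((le_max_right (p + 1) _).trans (hm _)) h)
    have h1a := hcl.mem_of_tendsto halim
      (Eventually.of_forall fun j => mem_iUnion.2 ⟨i j, j, rfl, rfl⟩)
    obtain ⟨l, j, -, hj⟩ := mem_iUnion.1 h1a
    exact hzy (i j) (k j) (by rw [hik, hj]; exact one_mem _)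
  · -- The sequence meets one of finitely many compact sets `{z l} ∪ {z l * y l k}` infinitely often.
    simp only [tendsto_atTop, not_forall, not_eventually, not_le] at hi
    obtain ⟨N, hN⟩ := hi
    have hcl : IsClosed (⋃ l ∈ Iio N, insert (z l) (range fun k => z l * y l k)) :=
      (finite_Iio N).isClosed_biUnion fun l _ => (hzlim l).isCompact_insert_range.isClosed
    have h1a := hcl.mem_of_frequently_of_tendsto
      (hN.mono fun j hj => mem_biUnion (mem_Iio.2 hj) (.inr ⟨k j, hik j⟩)) halim
    simp only [mem_iUnion] at h1a
    obtain ⟨l, -, h | ⟨j, h⟩⟩ := h1a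
    · exact hzp' l (h ▸ one_mem _)
    · exact hzy l j (mem_of_eq_of_mem h (one_mem (H (m l))))

/-- If all `H n` are locally compact, choose an increasing sequence of compact symmetric
neighbourhoods `D n` of `1` in `H n`. The union of the powers `D n ^ n` is an open subgroup, and it
is their inductive limit: for `x ∈ D n ^ n`, the neighbourhood `x • D n` of `x` in `H n` lies in
`D (n + 1) ^ (n + 1)`. -/
theorem exists_isOpen_subgroup_isMKOmegaSpace
    (hlim : IsInductiveLimit (fun n => (H n : Set X)))
    (hmetr : ∀ n, MetrizableSpace (H n)) (hlc : ∀ n, LocallyCompactSpace (H n)) :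
    ∃ Y : Subgroup X, IsOpen (Y : Set X) ∧ IsMKOmegaSpace Y := by
  have hHm : Monotone H := fun _ _ h => hlim.monotone h
  choose K hKc hK1 using fun n => exists_compact_mem_nhds (1 : H n)
  let D : ℕ → Set X := fun n => ⋃ i ∈ Iic n, (Subtype.val '' K i ∪ (Subtype.val '' K i)⁻¹)
  have hDc : ∀ n, IsCompact (D n) := fun n => (finite_Iic n).isCompact_biUnion fun i _ =>
    have := (hKc i).image continuous_subtype_val
    this.union this.inv
  have hDm : Monotone D := fun _ _ h => biUnion_subset_biUnion_left (Iic_subset_Iic.2 h)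
  have hDH : ∀ n, D n ⊆ H n := fun n => by
    refine iUnion₂_subset fun i hi => ?_
    rintro x (⟨y, -, rfl⟩ | ⟨y, -, hy⟩)
    · exact hHm hi y.2
    · exact hHm hi (inv_mem_iff.1 (hy ▸ y.2))
  have hKD : ∀ n, Subtype.val '' K n ⊆ D n := fun n x hx => mem_biUnion self_mem_Iic (.inl hx)
  have hD1 : ∀ n, 1 ∈ D n := fun n => hKD n ⟨1, mem_of_mem_nhds (hK1 n), rfl⟩
  have hDinv : ∀ n, (D n)⁻¹ = D n := fun n => by
    simp only [D, iUnion_inv, union_inv, inv_inv, union_comm]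
  have hDnhds : ∀ n, Subtype.val ⁻¹' D n ∈ 𝓝 (1 : H n) := fun n =>
    mem_of_superset (hK1 n) (image_subset_iff.1 (hKD n))
  have hPm : ∀ {i j k l : ℕ}, i ≤ k → j ≤ l → D i ^ j ⊆ D k ^ l := fun hi hj =>
    pow_subset_pow (hDm hi) (hD1 _) hj
  have hPc : ∀ n k, IsCompact (D n ^ k) := fun n k => by
    induction k with
    | zero => simp
    | succ k ih => rw [pow_succ]; exact ih.mul (hDc n)
  have hPH : ∀ n k, D n ^ k ⊆ H n := fun n k => by
    induction k with
    | zero => simp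
    | succ k ih =>
      rw [pow_succ]
      exact mul_subset_iff.2 fun a ha b hb => mul_mem (ih ha) (hDH n hb)
  let Y : Subgroup X :=
    { carrier := ⋃ n, D n ^ n
      one_mem' := mem_iUnion.2 ⟨0, by simp⟩
      mul_mem' := fun {a b} ha hb => by
        obtain ⟨i, hi⟩ := mem_iUnion.1 ha
        obtain ⟨j, hj⟩ := mem_iUnion.1 hb
        refine mem_iUnion.2 ⟨i + j, ?_⟩
        rw [pow_add]
        exact mul_mem_mul (hPm (Nat.le_add_right i j) le_rfl hi)
          (hPm (Nat.le_add_left j i) le_rfl hj)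
      inv_mem' := fun {a} ha => by
        obtain ⟨i, hi⟩ := mem_iUnion.1 ha
        refine mem_iUnion.2 ⟨i, ?_⟩
        rwa [← hDinv, inv_pow, Set.mem_inv, inv_inv] }
  have hPY : ∀ n, D n ^ n ⊆ Y := fun n => subset_iUnion (fun n => D n ^ n) n
  have hYopen : IsOpen (Y : Set X) := by
    refine (hlim.isOpen_iff _).2 fun n => ?_
    refine Subgroup.isOpen_of_mem_nhds (Y.subgroupOf (H n)) (g := 1) ?_
    refine mem_of_superset (hDnhds n) fun x hx => hPY (n + 1) ?_
    have h := hPm n.le_succ (Nat.le_add_left 1 n)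
    rw [pow_one] at h
    exact h hx
  have hTop : ∀ U : Set X, U ⊆ Y → (∀ n, IsOpen ((fun x : ↥(D n ^ n) => (x : X)) ⁻¹' U)) →
      IsOpen U := by
    intro U hUY hU
    refine (hlim.isOpen_iff _).2 fun n => isOpen_iff_mem_nhds.2 ?_
    rintro ⟨x, hxn⟩ (hxU : x ∈ U)
    obtain ⟨l, hl⟩ := mem_iUnion.1 (hUY hxU)
    let q := max n l
    have hxq : x ∈ D q ^ q := hPm (le_max_right n l) (le_max_right n l) hl
    -- It suffices to work in the larger group `H q`, where `x` lies in `D q ^ q`.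
    suffices h : Subtype.val ⁻¹' U ∈ 𝓝 (⟨x, hPH q q hxq⟩ : H q) from
      (continuous_inclusion (hHm (le_max_left n l))).continuousAt.preimage_mem_nhds
        (x := ⟨x, hxn⟩) h
    obtain ⟨W, hWo, hW⟩ := isOpen_induced_iff.1 (hU (q + 1))
    have hxP : ∀ d ∈ D q, x * d ∈ D (q + 1) ^ (q + 1) := fun d hd => by
      refine hPm q.le_succ le_rfl ?_
      rw [pow_succ]
      exact mul_mem_mul hxq hd
    have hUW : ∀ w ∈ D (q + 1) ^ (q + 1), w ∈ W ↔ w ∈ U := fun w hw =>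
      Set.ext_iff.1 hW ⟨w, hw⟩
    have hxW : x ∈ W := (hUW x (by simpa using hxP 1 (hD1 q))).2 hxU
    have h1 : Subtype.val ⁻¹' W ∈ 𝓝 (⟨x, hPH q q hxq⟩ : H q) :=
      (hWo.preimage continuous_subtype_val).mem_nhds hxW
    have h2 : (fun w : H q => (⟨x, hPH q q hxq⟩ : H q)⁻¹ * w) ⁻¹' (Subtype.val ⁻¹' D q) ∈
        𝓝 (⟨x, hPH q q hxq⟩ : H q) :=
      (continuous_const_mul _).continuousAt.preimage_mem_nhds (by simpa using hDnhds q)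
    filter_upwards [h1, h2] with w hw1 hw2
    exact (hUW w (by simpa using hxP _ hw2)).1 hw1
  refine ⟨Y, hYopen, fun n => Subtype.val ⁻¹' (D n ^ n), fun n => ?_, fun n => ?_, ?_⟩
  · rw [Subtype.isCompact_iff,
      image_preimage_eq_of_subset (by simpa [Subtype.range_coe_subtype] using hPY n)]
    exact hPc n n
  · have := hmetr n
    let f : ((Subtype.val ⁻¹' (D n ^ n) : Set Y)) → H n := fun x => ⟨x.1.1, hPH n n x.2⟩
    have hf : IsEmbedding f := by
      have h : IsEmbedding (Subtype.val ∘ f) :=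
        (IsEmbedding.subtypeVal (p := (· ∈ Y))).comp IsEmbedding.subtypeVal
      exact .of_comp (by fun_prop) continuous_subtype_val h
    exact hf.metrizableSpace
  · refine ⟨fun n => preimage_mono (hPm n.le_succ n.le_succ), ?_, fun U => ?_⟩
    · exact eq_univ_of_forall fun y => by simpa using mem_iUnion.1 y.2
    · refine ⟨fun hU n => hU.preimage continuous_subtype_val, fun hU => ?_⟩
      have h := hTop (Subtype.val '' U) (by rintro _ ⟨y, -, rfl⟩; exact y.2) fun n => ?_
      · simpa [preimage_image_eq _ Subtype.val_injective] using
          h.preimage (continuous_subtype_val (p := (· ∈ Y)))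
      · let g : ↥(D n ^ n) → (Subtype.val ⁻¹' (D n ^ n) : Set Y) :=
          fun x => ⟨⟨x, hPY n x.2⟩, x.2⟩
        have hg : Continuous g := by fun_prop
        convert (hU n).preimage hg using 1
        ext x
        exact Subtype.val_injective.mem_set_image (a := (g x).1)

end Tower

theorem theoremt {X : Type*} [Group X] [TopologicalSpace X] [IsTopologicalGroup X]
    (H : ℕ → Subgroup X)
    (hmetr : ∀ n, TopologicalSpace.MetrizableSpace (H n))
    (hclosed : ∀ n, IsClosed ((H n).subgroupOf (H (n + 1)) : Set (H (n + 1))))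
    (hlim : IsInductiveLimit (fun n => (H n : Set X))) :
    (IsAscoliSpace X ↔ (EventuallyOpenInNext H ∨ ∀ n, LocallyCompactSpace (H n))) ∧
    (EventuallyOpenInNext H → TopologicalSpace.MetrizableSpace X) ∧
    ((∀ n, LocallyCompactSpace (H n)) →
      (∃ Y : Subgroup X, IsOpen (Y : Set X) ∧ IsMKOmegaSpace Y) ∧ SequentialSpace X ∧
        (¬ EventuallyOpenInNext H → ¬ FrechetUrysohnSpace X)) := by
  have : T1Space X := hlim.t1Space fun n => have := hmetr n; inferInstanceAs (T1Space (H n))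
  have hseq : SequentialSpace X :=
    hlim.sequentialSpace fun n => have := hmetr n; inferInstanceAs (SequentialSpace (H n))
  have hcl : ∀ n, IsClosed (H n : Set X) := hlim.isClosed_of_isClosed_succ hclosed
  refine ⟨⟨fun _ => ?_, fun _ => ?_⟩, ?_, fun hlc => ⟨?_, hseq, ?_⟩⟩
  · exact or_iff_not_imp_left.2 fun h =>
      locallyCompactSpace_of_not_eventuallyOpenInNext hlim hmetr hcl h
  · let _ : UniformSpace X := IsTopologicalGroup.rightUniformSpace X
    have : T35Space X := {}
    exact isAscoliSpace_of_sequentialSpace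
  · rintro ⟨m, hm⟩
    have := hmetr m
    exact metrizableSpace_of_isOpen_subgroup (hlim.isOpen_of_isOpen_succ hm)
  · exact exists_isOpen_subgroup_isMKOmegaSpace hlim hmetr hlc
  · exact not_frechetUrysohnSpace_of_not_eventuallyOpenInNext hlim hmetr
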